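/- Let $G$ be a finite abelian group and $A$ a finite set of size $q\ge 2$. The group $G$ acts on the set $A^G$ of all functions $x:G\to A$ by $(x\cdot g)(h)=x(hg^{-1})$. A cellular automaton over $G$ and $A$ is a map $\tau:A^G\to A^G$ for which there are a finite set $S\subseteq G$ and a function $\mu:A^S\to A$ such that $\tau(x)(g)=\mu\big((x(sg))_{s\in S}\big)$ for all $x\in A^G$ and $g\in G$. Let $\mathrm{CA}(G;A)$ be the finite monoid, under composition, of all cellular automata over $G$ and $A$, and let $\mathrm{ICA}(G;A)$ be its group of invertible elements. For a subset $U$ of a finite monoid $M$, the relative rank $\mathrm{Rank}(M:U)$ is the minimum cardinality of a subset $V\subseteq M$ such that $U\cup V$ generates $M$. Write $[H]$ for the conjugacy class of a subgroup $H\le G$, and $[H]\le[K]$ if $H\le g^{-1}Kg$ for some $g\in G$. Let $\mathcal E_G$ be the set of all ordered pairs $([H],[K])$ with $[H]\le[K]$, including the pairs $([H],[H])$; as $G$ is abelian, this amounts to the set of pairs of subgroups $(H,K)$ with $H\le K$. Let $H_1,\dots,H_r$ be the list of the different subgroups of $G$, with $H_1=G$, and let $\alpha_i$ be the number of $G$-orbits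 on $A^G$ all of whose elements have stabiliser in $[H_i]=\{H_i\}$. Then $$\mathrm{Rank}\big(\mathrm{CA}(G;A):\mathrm{ICA}(G;A)\big)=|\mathcal E_G|-\sum_{i=2}^r\delta(\alpha_i,1),$$ where $\delta$ is Kronecker's delta. -/

import Mathlib

namespace CellAut

/-- `τ : A^G → A^G` is a cellular automaton: there are a finite memory set `S ⊆ G` and a local
function `μ : A^S → A` with `τ(x)(g) = μ((s ↦ x(s g))|_S)` for all `x ∈ A^G` and `g ∈ G`. -/
def IsCA {G A : Type*} [Group G] (τ : (G → A) → (G → A)) : Prop :=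
  ∃ (S : Finset G) (μ : (S → A) → A), ∀ (x : G → A) (g : G), τ x g = μ (fun s => x (s.1 * g))

theorem IsCA.id {G A : Type*} [Group G] : IsCA (fun x : G → A => x) :=
  ⟨{1}, fun y => y ⟨1, Finset.mem_singleton_self 1⟩, fun x g => by simp⟩

theorem IsCA.comp {G A : Type*} [Group G] {σ τ : (G → A) → (G → A)}
    (hσ : IsCA σ) (hτ : IsCA τ) : IsCA (fun x => σ (τ x)) := by
  classical
  obtain ⟨T, ν, hν⟩ := hσ
  obtain ⟨S, μ, hμ⟩ := hτ
  refine ⟨Finset.image₂ (fun s t => s * t) S T,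
    fun y => ν fun t => μ fun s => y ⟨s.1 * t.1, Finset.mem_image₂_of_mem s.2 t.2⟩, ?_⟩
  intro x g
  simp only [hν, hμ, mul_assoc]

/-- The monoid `CA(G;A)` of all cellular automata over `G` and `A`, under composition. -/
def CA (G A : Type*) [Group G] : Submonoid (Function.End (G → A)) where
  carrier := {τ | IsCA τ}
  one_mem' := IsCA.id
  mul_mem' {σ τ} hσ hτ := by
    have h1 : IsCA σ := hσ
    have h2 : IsCA τ := hτ
    have h3 := IsCA.comp h1 h2
    exact h3

instance instFiniteCA (G A : Type*) [Group G] [Finite G] [Finite A] : Finite (CA G A) :=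
  have : Finite (Function.End (G → A)) := inferInstanceAs (Finite ((G → A) → (G → A)))
  inferInstance

/-- The set `ICA(G;A)` of invertible cellular automata, as a subset of `CA(G;A)`. -/
def ICA (G A : Type*) [Group G] : Set (CA G A) :=
  {τ | ∃ φ : CA G A, τ * φ = 1 ∧ φ * τ = 1}

/-- The relative rank of a subset `U` of a finite monoid `M`: the minimum cardinality of a subset
`V ⊆ M` such that `U ∪ V` generates `M`. -/
noncomputable def relativeRank {M : Type*} [Monoid M] [Finite M] (U : Set M) : ℕ :=
  sInf {k | ∃ V : Set M, V.ncard = k ∧ Submonoid.closure (U ∪ V) = ⊤}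

/-- The infimum in the definition of the relative rank is a minimum. -/
theorem relativeRank_isLeast {M : Type*} [Monoid M] [Finite M] (U : Set M) :
    IsLeast {k | ∃ V : Set M, V.ncard = k ∧ Submonoid.closure (U ∪ V) = ⊤} (relativeRank U) :=
  ⟨Nat.sInf_mem ⟨_, Set.univ, rfl, by simp⟩, fun _ hk => Nat.sInf_le hk⟩

/-- The right action of `G` on configurations: `(x · g)(h) = x(h g⁻¹)`. -/
def shift {G A : Type*} [Group G] (x : G → A) (g : G) : G → A := fun h => x (h * g⁻¹)

theorem shift_one {G A : Type*} [Group G] (x : G → A) : shift x 1 = x := by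
  funext h; simp [shift]

theorem shift_mul {G A : Type*} [Group G] (x : G → A) (g k : G) :
    shift x (g * k) = shift (shift x g) k := by
  funext h; simp [shift, mul_assoc]

/-- The `G`-orbit `xG` of a configuration. -/
def orbit {G A : Type*} [Group G] (x : G → A) : Set (G → A) := {y | ∃ g : G, y = shift x g}

/-- The set of all `G`-orbits on `A^G`. -/
def orbits (G A : Type*) [Group G] : Set (Set (G → A)) := {O | ∃ x : G → A, O = orbit x}

/-- The stabiliser `G_x = {g : x · g = x}`. -/
def stabiliser {G A : Type*} [Group G] (x : G → A) : Subgroup G where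
  carrier := {g | shift x g = x}
  one_mem' := shift_one x
  mul_mem' {a b} ha hb := by
    change shift x a = x at ha
    change shift x b = x at hb
    change shift x (a * b) = x
    rw [shift_mul, ha, hb]
  inv_mem' {a} ha := by
    change shift x a = x at ha
    change shift x a⁻¹ = x
    conv_lhs => rw [← ha]
    rw [← shift_mul, mul_inv_cancel, shift_one]

/-- The conjugate subgroup `g⁻¹ H g`. -/
def conjBy {G : Type*} [Group G] (H : Subgroup G) (g : G) : Subgroup G :=
  H.map (MulAut.conj g⁻¹).toMonoidHom

theorem mem_conjBy {G : Type*} [Group G] {H : Subgroup G} {g k : G} :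
    k ∈ conjBy H g ↔ g * k * g⁻¹ ∈ H := by
  constructor
  · rintro ⟨h, hh, rfl⟩
    simpa [mul_assoc] using hh
  · intro h
    exact ⟨_, h, by simp [mul_assoc]⟩

/-- Conjugacy of subgroups of `G`: `H ∼ K` if `g⁻¹ H g = K` for some `g`. -/
def conjSetoid (G : Type*) [Group G] : Setoid (Subgroup G) where
  r H K := ∃ g : G, conjBy H g = K
  iseqv :=
    { refl := fun H => ⟨1, by ext k; simp [mem_conjBy]⟩
      symm := by
        rintro H K ⟨g, rfl⟩
        exact ⟨g⁻¹, by ext k; simp [mem_conjBy, mul_assoc]⟩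
      trans := by
        rintro H K L ⟨g, rfl⟩ ⟨k, rfl⟩
        exact ⟨g * k, by ext l; simp [mem_conjBy, mul_assoc]⟩ }

/-- The set of conjugacy classes of subgroups of `G`. -/
def ConjClass (G : Type*) [Group G] : Type _ := Quotient (conjSetoid G)

/-- The conjugacy class `[H]`. -/
def conjClass {G : Type*} [Group G] (H : Subgroup G) : ConjClass G := Quotient.mk (conjSetoid G) H

/-- The relation `[H] ≤ [K]` on conjugacy classes: `H ≤ g⁻¹ K g` for some `g ∈ G`. -/
def ConjClass.IsBelow {G : Type*} [Group G] (c d : ConjClass G) : Prop :=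
  ∃ H K : Subgroup G, conjClass H = c ∧ conjClass K = d ∧ ∃ g : G, H ≤ conjBy K g

/-- The edge set of the graph of conjugacy classes of subgroups: all ordered pairs
`([H], [K])` with `[H] ≤ [K]` (loops included). -/
def edges (G : Type*) [Group G] : Set (ConjClass G × ConjClass G) := {p | p.1.IsBelow p.2}

/-- `B_{[H]}`: the configurations whose stabiliser lies in the conjugacy class of `H`. -/
def box {G : Type*} [Group G] (H : Subgroup G) (A : Type*) : Set (G → A) :=
  {x | conjClass (stabiliser x) = conjClass H}

/-- `α_{[H]}(G;A)`: the number of `G`-orbits on `A^G` contained in `B_{[H]}`. -/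
noncomputable def alpha {G : Type*} [Group G] (H : Subgroup G) (A : Type*) : ℕ :=
  {O : Set (G → A) | O ∈ orbits G A ∧ O ⊆ box H A}.ncard

/-- Kronecker's delta. -/
def kronecker (a b : ℕ) : ℕ := if a = b then 1 else 0

end CellAut

namespace CellAut

/-! For finite `G` the cellular automata are exactly the equivariant self-maps of `A^G`, and such
maps can only enlarge stabilisers. The elementary non-units are collapses `redirect id x y`, which
send the orbit of `x` into a different orbit, that of `y`, and fix everything else; they exist when
the stabiliser `H` of `x` lies in the stabiliser `K` of `y`. The relative rank counts the pairs `(H,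
K)` so realised (`collapsePairs`).

Lower bound: in any factorisation of a collapse, the first non-unit applied has, up to units, the
same type `(H, K)` (`hasCollapseType_of_redirect_eq_comp`), and a map has at most one type
(`HasCollapseType.unique`). So distinct pairs need distinct generators.

Upper bound: collapses of one type differ only by units (`exists_bijective_map_pair`), and every
equivariant map is a product of collapses and units (`equivariant_induction`).

Every subgroup is a stabiliser, so a pair `H ≤ K` can fail only when `H = K` and there is a single
orbit with that stabiliser. -/

/-- A self-map of `A^G` is equivariant if it commutes with all shifts. -/
def Equivariant {G A : Type*} [Group G] (f : (G → A) → (G → A)) : Prop :=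
  ∀ (x : G → A) (g : G), f (shift x g) = shift (f x) g

theorem isCA_iff_equivariant {G A : Type*} [Group G] [Finite G] {f : (G → A) → (G → A)} :
    IsCA f ↔ Equivariant f := by
  classical
  constructor
  · rintro ⟨S, μ, h⟩ x g
    funext k
    simp only [shift, h, mul_assoc]
  · intro h
    have := Fintype.ofFinite G
    refine ⟨Finset.univ, fun y => f (fun s => y ⟨s, Finset.mem_univ s⟩) 1, fun x g => ?_⟩
    have h1 := congrFun (h x g⁻¹) 1
    have h2 : shift x g⁻¹ = fun s => x (s * g) := by
      funext s
      simp [shift]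
    rw [h2] at h1
    simp [h1, shift]

/-! ### Orbits, stabilisers and redirection of an orbit -/

section Group

variable {G A : Type*} [Group G]

theorem shift_shift_inv (x : G → A) (g : G) : shift (shift x g) g⁻¹ = x := by
  rw [← shift_mul, mul_inv_cancel, shift_one]

theorem mem_stabiliser {x : G → A} {g : G} : g ∈ stabiliser x ↔ shift x g = x := Iff.rfl

theorem shift_eq_shift_iff {x : G → A} {g h : G} :
    shift x g = shift x h ↔ g * h⁻¹ ∈ stabiliser x := by
  rw [mem_stabiliser, shift_mul]
  constructor
  · intro e
    rw [e, shift_shift_inv]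
  · intro e
    rw [← shift_mul] at e
    calc shift x g = shift (shift x (g * h⁻¹)) h := by rw [← shift_mul]; simp
      _ = shift x h := by rw [e]

theorem shift_mem_orbit (x : G → A) (g : G) : shift x g ∈ orbit x := ⟨g, rfl⟩

theorem mem_orbit_self (x : G → A) : x ∈ orbit x := ⟨1, (shift_one x).symm⟩

theorem mem_orbit_symm {x y : G → A} (h : y ∈ orbit x) : x ∈ orbit y := by
  obtain ⟨g, rfl⟩ := h
  exact ⟨g⁻¹, (shift_shift_inv x g).symm⟩

theorem mem_orbit_trans {x y z : G → A} (h : y ∈ orbit x) (h' : z ∈ orbit y) : z ∈ orbit x := by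
  obtain ⟨g, rfl⟩ := h
  obtain ⟨k, rfl⟩ := h'
  exact ⟨g * k, (shift_mul x g k).symm⟩

theorem shift_mem_orbit_iff {x y : G → A} {g : G} : shift y g ∈ orbit x ↔ y ∈ orbit x :=
  ⟨fun h => mem_orbit_trans h (mem_orbit_symm (shift_mem_orbit y g)),
    fun h => mem_orbit_trans h (shift_mem_orbit y g)⟩

theorem orbit_eq_orbit_iff {x y : G → A} : orbit y = orbit x ↔ y ∈ orbit x := by
  refine ⟨fun h => h ▸ mem_orbit_self y, fun h => Set.ext fun z => ⟨mem_orbit_trans h, ?_⟩⟩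
  exact mem_orbit_trans (mem_orbit_symm h)

theorem stabiliser_le_of_equivariant {f : (G → A) → (G → A)} (hf : Equivariant f) (x : G → A) :
    stabiliser x ≤ stabiliser (f x) := by
  intro g hg
  rw [mem_stabiliser] at hg ⊢
  rw [← hf, hg]

theorem Equivariant.stabiliser_eq_of_injOn {f : (G → A) → (G → A)} (hf : Equivariant f)
    {S : Set (G → A)} (hS : ∀ y ∈ S, ∀ g : G, shift y g ∈ S) (hi : Set.InjOn f S)
    {x : G → A} (hx : x ∈ S) : stabiliser (f x) = stabiliser x := by
  refine le_antisymm (fun g hg => ?_) (stabiliser_le_of_equivariant hf x)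
  rw [mem_stabiliser, ← hf] at hg
  exact hi (hS x hx g) hx hg

theorem Equivariant.comp {f g : (G → A) → (G → A)} (hf : Equivariant f) (hg : Equivariant g) :
    Equivariant (fun x => f (g x)) := fun x k => by
  beta_reduce
  rw [hg, hf]

theorem Equivariant.mem_orbit_image {f : (G → A) → (G → A)} (hf : Equivariant f) {x y : G → A}
    (h : y ∈ orbit x) : f y ∈ orbit (f x) := by
  obtain ⟨g, rfl⟩ := h
  exact ⟨g, hf x g⟩

theorem Equivariant.mem_orbit_image_iff {f : (G → A) → (G → A)} (hf : Equivariant f)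
    (hi : Function.Injective f) {x y : G → A} : f y ∈ orbit (f x) ↔ y ∈ orbit x := by
  refine ⟨?_, hf.mem_orbit_image⟩
  rintro ⟨g, hg⟩
  exact ⟨g, hi (by rw [hg, hf])⟩

open Classical in
/-- The map sending `x · g` to `w · g` for all `g`, and agreeing with `f` off the orbit of `x`. -/
noncomputable def redirect (f : (G → A) → (G → A)) (x w : G → A) : (G → A) → (G → A) :=
  fun y => if h : ∃ g : G, y = shift x g then shift w h.choose else f y

theorem redirect_shift {f : (G → A) → (G → A)} {x w : G → A}
    (h : stabiliser x ≤ stabiliser w) (g : G) : redirect f x w (shift x g) = shift w g := by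
  have hex : ∃ k : G, shift x g = shift x k := ⟨g, rfl⟩
  rw [redirect, dif_pos hex, eq_comm, shift_eq_shift_iff]
  exact h (shift_eq_shift_iff.1 hex.choose_spec)

theorem redirect_self {f : (G → A) → (G → A)} {x w : G → A}
    (h : stabiliser x ≤ stabiliser w) : redirect f x w x = w := by
  simpa only [shift_one] using redirect_shift (f := f) h 1

theorem redirect_of_notMem {f : (G → A) → (G → A)} {x w y : G → A} (h : y ∉ orbit x) :
    redirect f x w y = f y := dif_neg h

theorem Equivariant.redirect {f : (G → A) → (G → A)} (hf : Equivariant f) {x w : G → A}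
    (h : stabiliser x ≤ stabiliser w) : Equivariant (redirect f x w) := by
  intro y g
  by_cases hy : y ∈ orbit x
  · obtain ⟨k, rfl⟩ := hy
    rw [← shift_mul, redirect_shift h, redirect_shift h, shift_mul]
  · rw [redirect_of_notMem hy, redirect_of_notMem (mt shift_mem_orbit_iff.1 hy), hf]

theorem equivariant_id : Equivariant (id : (G → A) → (G → A)) := fun _ _ => rfl

/-- `f` identifies an orbit with stabiliser `H` with part of an orbit with stabiliser `K`, and is
injective elsewhere. -/
def HasCollapseType (f : (G → A) → (G → A)) (H K : Subgroup G) : Prop :=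
  ∃ x z : G → A, stabiliser x = H ∧ stabiliser z = K ∧ z ∉ orbit x ∧ f x = f z ∧
    Set.InjOn f (orbit x)ᶜ

theorem Equivariant.bijective_inverse {f g : (G → A) → (G → A)} (hf : Equivariant f)
    (hfg : Function.RightInverse g f) (hi : Function.Injective f) : Equivariant g := by
  intro x k
  apply hi
  rw [hf, hfg, hfg]

theorem mem_CA [Finite G] {τ : Function.End (G → A)} : τ ∈ CA G A ↔ Equivariant τ :=
  isCA_iff_equivariant

theorem mem_ICA_iff [Finite G] {τ : CA G A} : τ ∈ ICA G A ↔ Function.Bijective τ.1 := by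
  constructor
  · rintro ⟨φ, h1, h2⟩
    refine Function.bijective_iff_has_inverse.2 ⟨φ.1, fun x => ?_, fun x => ?_⟩
    · exact congrFun (congrArg Subtype.val h2) x
    · exact congrFun (congrArg Subtype.val h1) x
  · intro h
    obtain ⟨g, hl, hr⟩ := Function.bijective_iff_has_inverse.1 h
    refine ⟨⟨g, mem_CA.2 ((mem_CA.1 τ.2).bijective_inverse hr h.1)⟩, ?_, ?_⟩
    · exact Subtype.ext (funext hr)
    · exact Subtype.ext (funext hl)

theorem surjOn_of_mapsTo_of_injOn {α : Type*} [Finite α] {f : α → α} {S : Set α}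
    (hm : Set.MapsTo f S S) (hi : Set.InjOn f S) : Set.SurjOn f S S := by
  have h1 : Function.Injective (hm.restrict f S S) := hm.restrict_inj.2 hi
  have h2 := Finite.surjective_of_injective h1
  rwa [Set.MapsTo.restrict_surjective_iff] at h2

/-- In a factorisation of a non-unit, some non-unit generator is followed only by units. -/
theorem mem_closure_union_ICA [Finite G] {V : Set (CA G A)} {τ : CA G A}
    (h : τ ∈ Submonoid.closure (ICA G A ∪ V)) :
    τ ∈ ICA G A ∨ ∃ σ : CA G A, ∃ v ∈ V, ∃ u ∈ ICA G A, v ∉ ICA G A ∧ τ = σ * v * u := by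
  induction h using Submonoid.closure_induction_left with
  | one => exact Or.inl (mem_ICA_iff.2 Function.bijective_id)
  | mul_left x hx y hy ih =>
    rcases ih with ih | ⟨σ, v, hv, u, hu, hvu, rfl⟩
    · by_cases hxu : x ∈ ICA G A
      · exact Or.inl (mem_ICA_iff.2 ((mem_ICA_iff.1 hxu).comp (mem_ICA_iff.1 ih)))
      · exact Or.inr ⟨1, x, hx.resolve_left hxu, y, ih, hxu, by rw [one_mul]⟩
    · exact Or.inr ⟨x * σ, v, hv, u, hu, hvu, by simp only [mul_assoc]⟩

end Group

end CellAut

namespace CellAut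

section CommGroup

variable {G A : Type*} [CommGroup G]

theorem stabiliser_shift (x : G → A) (g : G) : stabiliser (shift x g) = stabiliser x := by
  ext k
  rw [mem_stabiliser, mem_stabiliser, ← shift_mul, shift_eq_shift_iff]
  simp [mem_stabiliser]

theorem stabiliser_eq_of_mem_orbit {x y : G → A} (h : y ∈ orbit x) :
    stabiliser y = stabiliser x := by
  obtain ⟨g, rfl⟩ := h
  exact stabiliser_shift x g

theorem notMem_orbit_shift {x z : G → A} (h : z ∉ orbit x) (g : G) : shift z g ∉ orbit x :=
  mt shift_mem_orbit_iff.1 h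

theorem compl_orbit_shift (x : G → A) : ∀ y ∈ (orbit x)ᶜ, ∀ g : G, shift y g ∈ (orbit x)ᶜ :=
  fun _ hy g => notMem_orbit_shift hy g

/-- If both types collapse the same orbit, injectivity off it identifies the targets up to a shift.
Otherwise each target lies in the orbit collapsed by the other type, so `K' = H` and `K = H'`, and
`H ≤ K`, `H' ≤ K'` make all four equal. -/
theorem HasCollapseType.unique {f : (G → A) → (G → A)} (hf : Equivariant f)
    {H K H' K' : Subgroup G} (h : HasCollapseType f H K) (h' : HasCollapseType f H' K') :
    H = H' ∧ K = K' := by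
  have le : ∀ {H K : Subgroup G}, HasCollapseType f H K → H ≤ K := by
    rintro H K ⟨x, z, rfl, rfl, hzx, he, hi⟩
    rw [← hf.stabiliser_eq_of_injOn (compl_orbit_shift x) hi hzx, ← he]
    exact stabiliser_le_of_equivariant hf x
  have hl := le h
  have hl' := le h'
  obtain ⟨x, z, rfl, rfl, hzx, he, hi⟩ := h
  obtain ⟨x', z', rfl, rfl, hzx', he', hi'⟩ := h'
  by_cases hx : x' ∈ orbit x
  · obtain ⟨g, rfl⟩ := hx
    refine ⟨(stabiliser_shift x g).symm, ?_⟩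
    have h1 : z' ∉ orbit x := fun h => hzx' (mem_orbit_trans
      (mem_orbit_symm (shift_mem_orbit x g)) h)
    have h2 : f z' = f (shift z g) := by rw [← he', hf, hf, he]
    rw [hi h1 (notMem_orbit_shift hzx g) h2, stabiliser_shift]
  · have key : ∀ {a b a' b' : G → A}, a' ∉ orbit a → f a' = f b' → a' ≠ b' →
        Set.InjOn f (orbit a)ᶜ → b' ∈ orbit a := by
      intro a b a' b' h1 h2 h3 h4
      by_contra h5
      exact h3 (h4 h1 h5 h2)
    have ne : ∀ {a b : G → A}, b ∉ orbit a → a ≠ b := by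
      rintro a b h rfl
      exact h (mem_orbit_self a)
    have h1 : z' ∈ orbit x := key (b := z) hx he' (ne hzx') hi
    have h2 : z ∈ orbit x' := key (b := z') (fun h => hx (mem_orbit_symm h)) he (ne hzx) hi'
    rw [stabiliser_eq_of_mem_orbit h1, stabiliser_eq_of_mem_orbit h2] at *
    exact ⟨le_antisymm hl hl', le_antisymm hl' hl⟩

/-- `f` inherits injectivity off the orbit of `x` from the collapse. Being non-injective, it must
then identify `x` with some `z` off that orbit, and applying `w` shows `z = y`. -/
theorem hasCollapseType_of_redirect_eq_comp [Finite G] [Finite A] {x y : G → A}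
    (hs : stabiliser x ≤ stabiliser y) {f w : (G → A) → (G → A)}
    (hf : Equivariant f) (he : ∀ a, redirect id x y a = w (f a)) (hf' : ¬ Function.Injective f) :
    HasCollapseType f (stabiliser x) (stabiliser y) := by
  have hi : Set.InjOn f (orbit x)ᶜ := by
    intro a ha b hb hab
    have h1 : redirect id x y a = redirect id x y b := by rw [he, he, hab]
    rwa [redirect_of_notMem ha, redirect_of_notMem hb] at h1
  suffices h : ∃ z ∉ orbit x, f x = f z by
    obtain ⟨z, hz, hxz⟩ := h
    refine ⟨x, z, rfl, ?_, hz, hxz, hi⟩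
    have h1 : redirect id x y x = redirect id x y z := by rw [he, he, hxz]
    rw [redirect_self hs, redirect_of_notMem hz] at h1
    rw [h1, id]
  by_contra! hne
  -- If the stabiliser grew, `f` would permute the configurations with stabiliser that of `f x`, all
  -- off the orbit of `x`, so one of them would share the image of `x`.
  have hstab : stabiliser (f x) = stabiliser x := by
    by_contra hL
    have hsub : ∀ a, stabiliser a = stabiliser (f x) → a ∉ orbit x := by
      intro a ha hax
      exact hL (ha.symm.trans (stabiliser_eq_of_mem_orbit hax))
    obtain ⟨a, ha, hax⟩ := surjOn_of_mapsTo_of_injOn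
      (f := f) (S := {a | stabiliser a = stabiliser (f x)})
      (fun a ha => (hf.stabiliser_eq_of_injOn (compl_orbit_shift x) hi (hsub a ha)).trans ha)
      (hi.mono hsub) (show f x ∈ _ from rfl)
    exact hne a (hsub a ha) hax.symm
  have hne' : ∀ g, ∀ b ∉ orbit x, f (shift x g) ≠ f b := by
    intro g b hb h
    refine hne (shift b g⁻¹) (notMem_orbit_shift hb _) ?_
    rw [hf, ← h, ← hf, shift_shift_inv]
  refine hf' fun a b hab => ?_
  by_cases ha : a ∈ orbit x <;> by_cases hb : b ∈ orbit x
  · obtain ⟨g, rfl⟩ := ha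
    obtain ⟨k, rfl⟩ := hb
    rw [hf, hf, shift_eq_shift_iff, hstab] at hab
    exact shift_eq_shift_iff.2 hab
  · obtain ⟨g, rfl⟩ := ha
    exact absurd hab (hne' g b hb)
  · obtain ⟨g, rfl⟩ := hb
    exact absurd hab.symm (hne' g a ha)
  · exact hi ha hb hab

theorem HasCollapseType.of_comp_bijective {f u : (G → A) → (G → A)} {H K : Subgroup G}
    (hu : Equivariant u) (hb : Function.Bijective u)
    (h : HasCollapseType (fun x => f (u x)) H K) : HasCollapseType f H K := by
  obtain ⟨x, z, rfl, rfl, hzx, he, hi⟩ := h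
  have hs : ∀ a, stabiliser (u a) = stabiliser a := fun a =>
    hu.stabiliser_eq_of_injOn (S := Set.univ) (fun _ _ _ => trivial) hb.1.injOn trivial
  refine ⟨u x, u z, hs x, hs z, mt (hu.mem_orbit_image_iff hb.1).1 hzx, he, ?_⟩
  intro a ha b hb' hab
  obtain ⟨a, rfl⟩ := hb.2 a
  obtain ⟨b, rfl⟩ := hb.2 b
  exact congrArg u (hi (mt hu.mem_orbit_image ha) (mt hu.mem_orbit_image hb') hab)

/-- A pair of subgroups is the type of an elementary collapse if there are two different orbits
with these stabilisers, the first contained in the second. -/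
def collapsePairs (G A : Type*) [CommGroup G] : Set (Subgroup G × Subgroup G) :=
  {p | ∃ x y : G → A, stabiliser x = p.1 ∧ stabiliser y = p.2 ∧ p.1 ≤ p.2 ∧ y ∉ orbit x}

theorem ncard_collapsePairs_le [Finite G] [Finite A] {V : Set (CA G A)}
    (hV : Submonoid.closure (ICA G A ∪ V) = ⊤) : (collapsePairs G A).ncard ≤ V.ncard := by
  have key : ∀ p ∈ collapsePairs G A, ∃ v ∈ V, HasCollapseType v.1 p.1 p.2 := by
    rintro ⟨H, K⟩ ⟨x, y, rfl, rfl, hle, hyx⟩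
    have hle : stabiliser x ≤ stabiliser y := hle
    let e : CA G A := ⟨redirect id x y, mem_CA.2 (equivariant_id.redirect hle)⟩
    have he : e ∉ ICA G A := by
      intro h
      have h1 : x = y := (mem_ICA_iff.1 h).1 (a₁ := x) (a₂ := y) (by
        change redirect id x y x = redirect id x y y
        rw [redirect_self hle, redirect_of_notMem hyx, id])
      exact hyx (h1 ▸ mem_orbit_self x)
    have hmem : e ∈ Submonoid.closure (ICA G A ∪ V) := hV ▸ Submonoid.mem_top e
    obtain ⟨σ, v, hv, u, hu, hvu, hfac⟩ := (mem_closure_union_ICA hmem).resolve_left he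
    have hub := mem_ICA_iff.1 hu
    have hue := mem_CA.1 u.2
    refine ⟨v, hv, HasCollapseType.of_comp_bijective hue hub ?_⟩
    refine hasCollapseType_of_redirect_eq_comp (w := σ.1) hle ((mem_CA.1 v.2).comp hue)
      (fun a => congrFun (congrArg Subtype.val hfac) a) fun hinj => hvu (mem_ICA_iff.2 ?_)
    refine Finite.injective_iff_bijective.1 fun a b hab => ?_
    obtain ⟨a, rfl⟩ := hub.2 a
    obtain ⟨b, rfl⟩ := hub.2 b
    exact congrArg u.1 (hinj hab)
  choose! v hvV hv using key
  refine Set.ncard_le_ncard_of_injOn v hvV (fun p hp q hq hpq => ?_) (Set.toFinite V)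
  have h1 := hv p hp
  rw [hpq] at h1
  exact Prod.ext_iff.2 (HasCollapseType.unique (mem_CA.1 (v q).2) h1 (hv q hq))

/-! ### Upper bound: units and collapses generate -/

/-- The transfer exchanging the orbits of `x` and `y` (or rotating their common orbit). -/
noncomputable def exchange (x y : G → A) : (G → A) → (G → A) := redirect (redirect id x y) y x

theorem exchange_spec [Finite G] [Finite A] {x y : G → A} (h : stabiliser x = stabiliser y) :
    Equivariant (exchange x y) ∧ Function.Bijective (exchange x y) ∧ exchange x y y = x ∧
      ∀ z, z ∉ orbit x → z ∉ orbit y → exchange x y z = z := by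
  have hz : ∀ z, z ∉ orbit x → z ∉ orbit y → exchange x y z = z := fun z h1 h2 => by
    rw [exchange, redirect_of_notMem h2, redirect_of_notMem h1, id]
  have hy : ∀ g, exchange x y (shift y g) = shift x g := fun g => redirect_shift h.ge g
  refine ⟨(equivariant_id.redirect h.le).redirect h.ge, Finite.surjective_iff_bijective.1 ?_,
    redirect_self h.ge, hz⟩
  intro z
  by_cases h1 : z ∈ orbit x
  · obtain ⟨g, rfl⟩ := h1
    exact ⟨_, hy g⟩
  by_cases h2 : z ∈ orbit y
  · have h3 : x ∉ orbit y := fun h3 => h1 (mem_orbit_trans (mem_orbit_symm h3) h2)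
    obtain ⟨g, rfl⟩ := h2
    refine ⟨shift x g, ?_⟩
    rw [exchange, redirect_of_notMem (notMem_orbit_shift h3 g), redirect_shift h.le]
  · exact ⟨z, hz z h1 h2⟩

theorem exists_bijective_map_pair [Finite G] [Finite A] {x y x' y' : G → A}
    (hx : stabiliser x = stabiliser x') (hy : stabiliser y = stabiliser y') (h : y ∉ orbit x)
    (h' : y' ∉ orbit x') : ∃ φ : (G → A) → (G → A), Equivariant φ ∧ Function.Bijective φ ∧
      φ x = x' ∧ φ y = y' := by
  obtain ⟨he, hb, h1, -⟩ := exchange_spec hx.symm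
  set s := exchange x' x
  have hs : stabiliser (s y) = stabiliser y :=
    he.stabiliser_eq_of_injOn (S := Set.univ) (fun _ _ _ => trivial) hb.1.injOn trivial
  obtain ⟨he', hb', h1', h2'⟩ := exchange_spec (hy.symm.trans hs.symm)
  refine ⟨fun z => exchange y' (s y) (s z), he'.comp he, hb'.comp hb, ?_, h1'⟩
  beta_reduce
  rw [h1]
  -- The second exchange must not disturb `x'`, which lies in neither of the orbits it moves.
  refine h2' x' (fun h => h' (mem_orbit_symm h)) fun h3 => ?_
  rw [← h1] at h3
  exact h (mem_orbit_symm ((he.mem_orbit_image_iff hb.1).1 h3))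

/-- Peel off one collapse at a time: redirecting a superfluous orbit onto a missed one brings the
map closer to a bijection, and a collapse undoes the change. -/
theorem equivariant_induction [Finite G] [Finite A] {P : ((G → A) → (G → A)) → Prop}
    (unit : ∀ f, Equivariant f → Function.Bijective f → P f)
    (step : ∀ f x y, Equivariant f → P f → stabiliser x ≤ stabiliser y → y ∉ orbit x →
      P (fun a => redirect id x y (f a)))
    (f : (G → A) → (G → A)) (hf : Equivariant f) : P f := by
  let missed (f : (G → A) → (G → A)) : Set (G → A) :=
    {y | ∀ x, stabiliser x = stabiliser y → f x ≠ y}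
  induction hn : (missed f).ncard using Nat.strong_induction_on generalizing f with
  | _ n ih =>
  subst hn
  by_cases hne : (missed f).Nonempty
  swap
  · refine unit f hf (Finite.surjective_iff_bijective.1 fun y => ?_)
    by_contra! h
    exact hne ⟨y, fun x _ => h x⟩
  -- Minimality puts `w` outside the whole image: a preimage would have a strictly smaller
  -- stabiliser, but `f` maps the configurations with that stabiliser exactly onto themselves.
  obtain ⟨w, hw, hmin⟩ := Set.exists_min_image (missed f) (fun y => Nat.card (stabiliser y))
    (Set.toFinite _) hne
  have hwf : ∀ x, f x ≠ w := by
    intro x hx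
    have hle : stabiliser x ≤ stabiliser w := hx ▸ stabiliser_le_of_equivariant hf x
    have hlt : stabiliser x < stabiliser w := lt_of_le_of_ne hle fun h => hw x h hx
    have hsurj : Set.SurjOn f {a | stabiliser a = stabiliser x}
        {a | stabiliser a = stabiliser x} := by
      intro y hy
      have hy : stabiliser y = stabiliser x := hy
      have hy' : y ∉ missed f := by
        intro h
        have h1 := hmin y h
        rw [hy] at h1
        exact hlt.ne (SetLike.coe_injective
          (Set.eq_of_subset_of_ncard_le hlt.le h1 (Set.toFinite _)))
      simp only [missed, Set.mem_ofPred_eq, not_forall, not_not] at hy'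
      obtain ⟨a, ha, hay⟩ := hy'
      exact ⟨a, ha.trans hy, hay⟩
    have himg : {a | stabiliser a = stabiliser x} = f '' {a | stabiliser a = stabiliser x} :=
      Set.eq_of_subset_of_ncard_le hsurj (Set.ncard_image_le (Set.toFinite _)) (Set.toFinite _)
    have hwx : w ∈ {a | stabiliser a = stabiliser x} := himg ▸ ⟨x, rfl, hx⟩
    exact hlt.ne hwx.symm
  have hwf' : ∀ x, f x ∉ orbit w := by
    intro x h
    obtain ⟨g, hg⟩ := mem_orbit_symm h
    exact hwf (shift x g) (by rw [hf, hg])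
  -- The orbit of `x` can be spared: its image has a larger stabiliser or is also reached from
  -- another `z` with the same stabiliser. Without such an `x`, `f` would permute the configurations
  -- with the stabiliser of `w` and hit `w`.
  obtain ⟨x, hxw, hx⟩ : ∃ x, stabiliser x = stabiliser w ∧
      (stabiliser (f x) = stabiliser x → ∃ z ≠ x, stabiliser z = stabiliser x ∧ f z = f x) := by
    by_contra! h
    obtain ⟨x, -, hx⟩ := surjOn_of_mapsTo_of_injOn (f := f)
      (S := {a | stabiliser a = stabiliser w}) (fun x hx => (h x hx).1.trans hx)
      (fun a ha b hb hab => by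
        by_contra hne
        exact (h b hb).2 a hne (Eq.trans ha (Eq.symm hb)) hab)
      (show w ∈ _ from rfl)
    exact hwf x hx
  have hf' : Equivariant (redirect f x w) := hf.redirect hxw.le
  have hle : stabiliser w ≤ stabiliser (f x) := hxw ▸ stabiliser_le_of_equivariant hf x
  have hfac : f = fun a => redirect id w (f x) (redirect f x w a) := by
    funext a
    by_cases ha : a ∈ orbit x
    · obtain ⟨g, rfl⟩ := ha
      rw [redirect_shift hxw.le, redirect_shift hle, hf]
    · rw [redirect_of_notMem ha, redirect_of_notMem (hwf' a), id]
  have hlt : (missed (redirect f x w)).ncard < (missed f).ncard := by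
    refine Set.ncard_lt_ncard ⟨fun y hy a hay hfa => ?_, fun h => ?_⟩ (Set.toFinite _)
    · by_cases ha : a ∈ orbit x
      · obtain ⟨g, rfl⟩ := ha
        rw [stabiliser_shift] at hay
        rw [hf] at hfa
        have hx' : stabiliser (f x) = stabiliser x := by rw [hay, ← hfa, stabiliser_shift]
        obtain ⟨z, hzx, hz, hfz⟩ := hx hx'
        have hzo : z ∉ orbit x := by
          rintro ⟨k, rfl⟩
          rw [hf, ← mem_stabiliser, hx', mem_stabiliser] at hfz
          exact hzx hfz
        refine hy (shift z g) (by rw [stabiliser_shift, hz, hay]) ?_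
        rw [redirect_of_notMem (notMem_orbit_shift hzo g), hf, hfz, hfa]
      · exact hy a hay (by rw [redirect_of_notMem ha, hfa])
    · exact h hw x hxw (redirect_self hxw.le)
  rw [hfac]
  exact step _ w (f x) hf' (ih _ hlt _ hf' rfl) hle (hwf' x)

theorem exists_generating_set [Finite G] [Finite A] : ∃ V : Set (CA G A),
    V.ncard ≤ (collapsePairs G A).ncard ∧ Submonoid.closure (ICA G A ∪ V) = ⊤ := by
  have hex : ∀ p ∈ collapsePairs G A, ∃ e : CA G A, ∃ x y : G → A, stabiliser x = p.1 ∧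
      stabiliser y = p.2 ∧ y ∉ orbit x ∧ e.1 = redirect id x y := by
    rintro p ⟨x, y, hx, hy, hle, hyx⟩
    exact ⟨⟨redirect id x y, mem_CA.2 (equivariant_id.redirect (hx ▸ hy ▸ hle))⟩,
      x, y, hx, hy, hyx, rfl⟩
  have : Nonempty (CA G A) := ⟨1⟩
  choose! e he using hex
  refine ⟨e '' collapsePairs G A, Set.ncard_image_le (Set.toFinite _), ?_⟩
  set M := Submonoid.closure (ICA G A ∪ e '' collapsePairs G A)
  have unit : ∀ τ : CA G A, Function.Bijective τ.1 → τ ∈ M := fun τ h =>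
    Submonoid.subset_closure (Or.inl (mem_ICA_iff.2 h))
  have collapse : ∀ (τ : CA G A) (x y : G → A), stabiliser x ≤ stabiliser y → y ∉ orbit x →
      τ.1 = redirect id x y → τ ∈ M := by
    intro τ x y hle hyx hτ
    have hp : (stabiliser x, stabiliser y) ∈ collapsePairs G A := ⟨x, y, rfl, rfl, hle, hyx⟩
    obtain ⟨x', y', hx, hy, hyx', hee⟩ := he _ hp
    obtain ⟨φ, hφ, hb, rfl, rfl⟩ := exists_bijective_map_pair hx.symm hy.symm hyx hyx'
    obtain ⟨ψ, hl, hr⟩ := Function.bijective_iff_has_inverse.1 hb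
    have hψ : Equivariant ψ := hφ.bijective_inverse hr hb.1
    -- The given collapse is the conjugate of the chosen one by the unit `φ`.
    have hfac : τ = ⟨ψ, mem_CA.2 hψ⟩ * e (stabiliser x, stabiliser y) * ⟨φ, mem_CA.2 hφ⟩ := by
      refine Subtype.ext (funext fun a => hb.1 ?_)
      change φ (τ.1 a) = φ (ψ ((e (stabiliser x, stabiliser y)).1 (φ a)))
      have hle' : stabiliser (φ x) ≤ stabiliser (φ y) := hx.trans_le (hle.trans hy.ge)
      rw [hr, hee, hτ]
      by_cases ha : a ∈ orbit x
      · obtain ⟨g, rfl⟩ := ha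
        rw [redirect_shift hle, hφ, hφ, redirect_shift hle']
      · rw [redirect_of_notMem ha,
          redirect_of_notMem (mt (hφ.mem_orbit_image_iff hb.1).1 ha), id, id]
    rw [hfac]
    exact M.mul_mem (M.mul_mem (unit _ (Function.bijective_iff_has_inverse.2 ⟨φ, hr, hl⟩))
      (Submonoid.subset_closure (Or.inr ⟨_, hp, rfl⟩))) (unit _ hb)
  refine eq_top_iff.2 fun τ _ => ?_
  refine equivariant_induction (P := fun f => ∀ τ : CA G A, τ.1 = f → τ ∈ M) ?_ ?_ τ.1
    (mem_CA.1 τ.2) τ rfl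
  · rintro _ - hb τ rfl
    exact unit τ hb
  · intro f x y hf ih hle hyx τ hτ
    have hfac : τ = ⟨redirect id x y, mem_CA.2 (equivariant_id.redirect hle)⟩ *
        ⟨f, mem_CA.2 hf⟩ := Subtype.ext hτ
    rw [hfac]
    exact M.mul_mem (collapse _ x y hle hyx rfl) (ih _ rfl)

theorem relativeRank_ICA [Finite G] [Finite A] :
    relativeRank (ICA G A) = (collapsePairs G A).ncard := by
  obtain ⟨hmem, hmin⟩ := relativeRank_isLeast (ICA G A)
  obtain ⟨W, hW, hcl⟩ := exists_generating_set (G := G) (A := A)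
  obtain ⟨V, hV, hV'⟩ := hmem
  exact le_antisymm ((hmin ⟨W, rfl, hcl⟩).trans hW) (hV ▸ ncard_collapsePairs_le hV')

/-! ### Counting the realised pairs of subgroups -/

theorem conjClass_eq_iff {H K : Subgroup G} : conjClass H = conjClass K ↔ H = K := by
  refine ⟨fun h => ?_, congrArg _⟩
  obtain ⟨g, rfl⟩ := Quotient.exact h
  ext k
  simp [mem_conjBy]

theorem ncard_edges : (edges G).ncard = {p : Subgroup G × Subgroup G | p.1 ≤ p.2}.ncard := by
  have himg : edges G = (fun p : Subgroup G × Subgroup G => (conjClass p.1, conjClass p.2)) ''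
      {p | p.1 ≤ p.2} := by
    ext ⟨c, d⟩
    constructor
    · rintro ⟨H, K, rfl, rfl, g, hg⟩
      refine ⟨(H, K), fun k hk => ?_, rfl⟩
      simpa [mem_conjBy] using hg hk
    · rintro ⟨⟨H, K⟩, hle, he⟩
      obtain ⟨rfl, rfl⟩ := Prod.ext_iff.1 he
      exact ⟨H, K, rfl, rfl, 1, fun k hk => mem_conjBy.2 (by simpa using hle hk)⟩
  rw [himg, Set.ncard_image_of_injective]
  rintro ⟨H, K⟩ ⟨H', K'⟩ h
  obtain ⟨h1, h2⟩ := Prod.ext_iff.1 h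
  exact Prod.ext (conjClass_eq_iff.1 h1) (conjClass_eq_iff.1 h2)

theorem mem_box {H : Subgroup G} {x : G → A} : x ∈ box H A ↔ stabiliser x = H := conjClass_eq_iff

theorem exists_stabiliser_eq (hA : 2 ≤ Nat.card A) (H : Subgroup G) :
    ∃ x : G → A, stabiliser x = H := by
  classical
  have : Finite A := Nat.finite_of_card_ne_zero (by lia)
  obtain ⟨a, b, hab⟩ :=
    (Finite.one_lt_card_iff_nontrivial.1 (by lia : 1 < Nat.card A)).exists_pair_ne
  -- The indicator function of `H` has stabiliser exactly `H`.
  refine ⟨fun g => if g ∈ H then a else b, ?_⟩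
  ext k
  rw [mem_stabiliser]
  constructor
  · intro h
    have h1 := congrFun h k
    simp only [shift, mul_inv_cancel, one_mem, if_true] at h1
    by_contra hk
    rw [if_neg hk] at h1
    exact hab h1
  · intro hk
    funext g
    simp only [shift, H.mul_mem_cancel_right (H.inv_mem hk)]

theorem orbit_subset_box_iff {H : Subgroup G} {x : G → A} :
    orbit x ⊆ box H A ↔ stabiliser x = H := by
  refine ⟨fun h => mem_box.1 (h (mem_orbit_self x)), fun h y hy => mem_box.2 ?_⟩
  rw [stabiliser_eq_of_mem_orbit hy, h]

theorem alpha_eq_one_iff [Finite G] (hA : 2 ≤ Nat.card A) (H : Subgroup G) :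
    alpha H A = 1 ↔ ∀ x y : G → A, stabiliser x = H → stabiliser y = H → y ∈ orbit x := by
  rw [alpha, Set.ncard_eq_one]
  constructor
  · rintro ⟨O, hO⟩ x y hx hy
    have key : ∀ z, stabiliser z = H → orbit z = O := fun z hz => by
      have h1 : orbit z ∈ ({O} : Set (Set (G → A))) :=
        hO ▸ ⟨⟨z, rfl⟩, orbit_subset_box_iff.2 hz⟩
      exact h1
    exact orbit_eq_orbit_iff.1 ((key y hy).trans (key x hx).symm)
  · intro h
    obtain ⟨x, hx⟩ := exists_stabiliser_eq hA H
    refine ⟨orbit x, Set.ext fun O => ⟨?_, ?_⟩⟩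
    · rintro ⟨⟨y, rfl⟩, hy⟩
      exact orbit_eq_orbit_iff.2 (h x y hx (orbit_subset_box_iff.1 hy))
    · rintro rfl
      exact ⟨⟨x, rfl⟩, orbit_subset_box_iff.2 hx⟩

/-- Two distinct constant configurations are distinct fixed points; hence omitting the index of `G`
from the sum loses nothing. -/
theorem alpha_top_ne_one [Finite G] (hA : 2 ≤ Nat.card A) : alpha (⊤ : Subgroup G) A ≠ 1 := by
  have : Finite A := Nat.finite_of_card_ne_zero (by lia)
  obtain ⟨a, b, hab⟩ :=
    (Finite.one_lt_card_iff_nontrivial.1 (by lia : 1 < Nat.card A)).exists_pair_ne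
  rw [Ne, alpha_eq_one_iff hA]
  intro h
  have hc : ∀ c : A, stabiliser (fun _ : G => c) = ⊤ := fun c => eq_top_iff.2 fun g _ => rfl
  obtain ⟨g, hg⟩ := h (fun _ => a) (fun _ => b) (hc a) (hc b)
  exact hab (congrFun hg 1).symm

theorem collapsePairs_eq [Finite G] (hA : 2 ≤ Nat.card A) :
    collapsePairs G A = {p | p.1 ≤ p.2} \ (fun H => (H, H)) '' {H | alpha H A = 1} := by
  ext ⟨H, K⟩
  constructor
  · rintro ⟨x, y, hx, hy, hle, hyx⟩
    refine ⟨hle, ?_⟩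
    rintro ⟨L, hL, he⟩
    obtain ⟨rfl, rfl⟩ := Prod.ext_iff.1 he
    exact hyx ((alpha_eq_one_iff hA L).1 hL x y hx hy)
  · rintro ⟨hle, hne⟩
    by_cases hHK : H = K
    · subst hHK
      have h1 : alpha H A ≠ 1 := fun h => hne ⟨H, h, rfl⟩
      rw [Ne, alpha_eq_one_iff hA] at h1
      push Not at h1
      obtain ⟨x, y, hx, hy, hyx⟩ := h1
      exact ⟨x, y, hx, hy, le_rfl, hyx⟩
    · obtain ⟨x, hx⟩ := exists_stabiliser_eq hA H
      obtain ⟨y, hy⟩ := exists_stabiliser_eq hA K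
      refine ⟨x, y, hx, hy, hle, fun h => hHK ?_⟩
      rw [← hx, ← hy, stabiliser_eq_of_mem_orbit h]

end CommGroup

end CellAut

theorem mainTheorem1 {G A : Type*} [CommGroup G] [Finite G] [Finite A] (hA : 2 ≤ Nat.card A)
    (r : ℕ) [NeZero r] (H : Fin r → Subgroup G) (hH : Function.Bijective H) (hH1 : H 0 = ⊤) :
    (CellAut.relativeRank (CellAut.ICA G A) : ℤ) =
      ((CellAut.edges G).ncard : ℤ) -
        ∑ i ∈ Finset.univ.erase (0 : Fin r),
          (CellAut.kronecker (CellAut.alpha (H i) A) 1 : ℤ) := by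
  open CellAut in
  have hsum : ∑ i ∈ Finset.univ.erase (0 : Fin r), (kronecker (alpha (H i) A) 1 : ℤ) =
      ({K : Subgroup G | alpha K A = 1}.ncard : ℤ) := by
    have himg : {K : Subgroup G | alpha K A = 1} =
        H '' ((Finset.univ.erase (0 : Fin r)).filter fun i => alpha (H i) A = 1) := by
      ext K
      obtain ⟨i, rfl⟩ := hH.2 K
      rw [hH.1.mem_set_image]
      have h0 : alpha (H i) A = 1 → i ≠ 0 := by
        rintro h rfl
        exact alpha_top_ne_one hA (hH1 ▸ h)
      simpa using h0
    rw [himg, Set.ncard_image_of_injective _ hH.1, Set.ncard_coe_finset]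
    simp [kronecker]
  rw [hsum, CellAut.relativeRank_ICA, CellAut.collapsePairs_eq hA, CellAut.ncard_edges,
    ← Set.ncard_image_of_injective {K : Subgroup G | CellAut.alpha K A = 1}
      (f := fun K => (K, K)) fun _ _ h => (Prod.ext_iff.1 h).1, eq_sub_iff_add_eq]
  exact_mod_cast Set.ncard_sdiff_add_ncard_of_subset (by rintro _ ⟨K, -, rfl⟩; exact le_refl K)
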